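/- Theorem 7 (maximal downlink energy efficiency). **Model.** A base station (BS) with $M\ge 0$ antennas serves a single-antenna user, assisted by a reflecting surface with $N\ge 0$ elements. The direct channel $\mathbf h_d\in\mathbb C^M$, the BS–surface channel $\mathbf G\in\mathbb C^{M\times N}$ and the surface–user channel $\mathbf h_r\in\mathbb C^N$ are mutually independent, and each has i.i.d. entries with zero mean and finite positive variance (for example Rayleigh fading), of a law that does not depend on $M,N$. The surface applies phase shifts $\theta_i\in[0,2\pi]$ with random phase errors $\Delta\theta_i$, whose joint law is arbitrary and which are independent of the channels. The overall channel is $\hat{\mathbf h}=\mathbf h_d+\mathbf G\,\mathrm{diag}(e^{j(\theta_1+\Delta\theta_1)},\dots,e^{j(\theta_N+\Delta\theta_N)})\,\mathbf h_r$. When the BS sends $\mathbf x\in\mathbb C^M$ with $\mathbb E\|\mathbf x\|^2=p_b$, the user receives $$y=\hat{\mathbf h}^{\mathrm H}(\mathbf x+\boldsymbol\eta_b)+\eta_u+n,$$ where, given the channel, $\boldsymbol\eta_b\sim\mathcal{CN}(\mathbf 0,\boldsymbol\Upsilon)$ with $\boldsymbol\Upsilon=\kappa_b\,\mathrm{diag}(\mathbb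 E\{\mathbf x\mathbf x^{\mathrm H}\})$, $\eta_u\sim\mathcal{CN}(0,v_u)$ with $v_u=\kappa_u\hat{\mathbf h}^{\mathrm H}(\mathbb E\{\mathbf x\mathbf x^{\mathrm H}\}+\boldsymbol\Upsilon)\hat{\mathbf h}$, and $n\sim\mathcal{CN}(0,\sigma_u^2)$ are independent of each other and of $\mathbf x$. Here $\kappa_b\ge 0$, $\kappa_u>0$, $\sigma_u^2>0$. **Capacity.** Let $\mathcal H=(\mathbf h_d,\mathbf G,\mathbf h_r,(\Delta\theta_i)_i)$ be the actual state and let $\mathcal H_b$, $\mathcal H_u$ be the information about it at the BS and at the user, with an arbitrary joint law with $\mathcal H$, which may depend on $M$, $N$, $p_b$ and on the pilot power $p_u$. The downlink capacity is $$C_d=\frac{\tau_d}{\tau}\,\sup\,\mathbb E\{\mathcal I(\mathbf x;y\mid\mathcal H,\mathcal H_b,\mathcal H_u)\}$$ (in bits), where the expectation is over $(\mathcal H,\mathcal H_b,\mathcal H_u)$ and the supremum is over all choices, as functions of $\mathcal H_b$, of a conditional law $f(\mathbf x\mid\mathcal H_b)$ of power $p_b$ and of phase shifts $(\theta_i)_i$.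 **Energy efficiency.** Let $\tau,\tau_d,\zeta>0$, $\tau_u,\tau_{pilot},\rho\ge 0$, and $$\Xi=\frac{C_d}{\frac{\tau_d}{\tau_u+\tau_d}\left(\frac{\tau_{pilot}\,p_u}{\tau}+M\rho+\zeta\right)+\frac{\tau_d\,p_b}{\tau}}.$$ Let $\Xi^{\max}(M)$ be the supremum of $\Xi$ over $p_b,p_u\ge0$ and $N\ge 0$, and $\Xi^{\max}=\sup_{M\ge0}\Xi^{\max}(M)$. **Claim.** If $\rho=0$, then $$\frac{\log_2\left(1+\frac1{\kappa_b+\kappa_u(1+\kappa_b)}\right)}{\frac{\tau\zeta}{\tau_u+\tau_d}}\;\le\;\Xi^{\max}\;\le\;\frac{\log_2\left(1+\frac1{\kappa_u}\right)}{\frac{\tau\zeta}{\tau_u+\tau_d}}.$$ If $\rho>0$, then the same upper bound on $\Xi^{\max}$ holds, $\Xi^{\max}(M)\to0$ as $M\to\infty$, and there is a finite $M$ with $\Xi^{\max}(M)=\Xi^{\max}$. -/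

import Mathlib

open MeasureTheory ProbabilityTheory Filter Topology
open scoped NNReal ENNReal

noncomputable section

namespace IRS

/-- Circularly symmetric complex Gaussian law `CN(0, v)`: independent real and imaginary parts,
each centred Gaussian of variance `v / 2`. -/
def cscg (v : ℝ≥0) : Measure ℂ :=
  ((gaussianReal 0 (v / 2)).prod (gaussianReal 0 (v / 2))).map (fun p => (⟨p.1, p.2⟩ : ℂ))

/-- Mutual information, in bits, of the two coordinates of a random pair with joint law `J`:
the relative entropy of `J` with respect to the product of its marginals. -/
def mutualInfo {α β : Type*} [MeasurableSpace α] [MeasurableSpace β] (J : Measure (α × β)) :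
    ℝ≥0∞ :=
  InformationTheory.klDiv J (J.fst.prod J.snd) / ENNReal.ofReal (Real.log 2)

/-- Law of one entry of a fading link: zero mean and finite positive variance. -/
structure IsFadingLaw (ν : Measure ℂ) : Prop where
  prob : IsProbabilityMeasure ν
  memLp : MemLp (fun z : ℂ => z) 2 ν
  mean_zero : ∫ z, z ∂ν = 0
  var_pos : 0 < ∫ z, ‖z‖ ^ 2 ∂ν

/-- The parameters of the system that do not depend on the transmit powers, on the number of
antennas or on the number of reflecting elements. -/
structure System where
  /-- impairment level of the base station -/
  κb : ℝ≥0
  /-- impairment level of the user -/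
  κu : ℝ≥0
  κu_pos : 0 < κu
  /-- variance of the thermal noise at the user -/
  σ2 : ℝ≥0
  σ2_pos : 0 < σ2
  /-- length of the coherence period -/
  τ : ℝ≥0
  τ_pos : 0 < τ
  /-- time spent on pilots -/
  τpilot : ℝ≥0
  /-- uplink data transmission time -/
  τu : ℝ≥0
  /-- downlink data transmission time -/
  τd : ℝ≥0
  τd_pos : 0 < τd
  /-- circuit power per base station antenna -/
  ρ : ℝ≥0
  /-- static circuit power -/
  ζ : ℝ≥0
  ζ_pos : 0 < ζ
  /-- law of the entries of the direct channel -/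
  νd : Measure ℂ
  νd_fading : IsFadingLaw νd
  /-- law of the entries of the channel between base station and reflecting surface -/
  νg : Measure ℂ
  νg_fading : IsFadingLaw νg
  /-- law of the entries of the channel between reflecting surface and user -/
  νr : Measure ℂ
  νr_fading : IsFadingLaw νr
  /-- joint law of the phase errors of `N` reflecting elements -/
  phaseLaw : (N : ℕ) → Measure (Fin N → ℝ)
  phaseLaw_prob : ∀ N, IsProbabilityMeasure (phaseLaw N)

/-- Actual state of the propagation environment with `M` antennas and `N` reflecting elements:
`(h_d, G, h_r, Δθ)`. -/
abbrev State (M N : ℕ) : Type :=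
  (Fin M → ℂ) × (Fin M → Fin N → ℂ) × (Fin N → ℂ) × (Fin N → ℝ)

/-- Law of the state: all entries of `h_d`, `G`, `h_r` are independent, identically distributed
within each of the three links, and independent of the phase errors. -/
def System.stateLaw (S : System) (M N : ℕ) : Measure (State M N) :=
  (Measure.pi fun _ : Fin M => S.νd).prod
    ((Measure.pi fun _ : Fin M => Measure.pi fun _ : Fin N => S.νg).prod
      ((Measure.pi fun _ : Fin N => S.νr).prod (S.phaseLaw N)))

variable {M N : ℕ}

/-- Overall channel `h_d + G diag(exp(j(θ_i + Δθ_i))) h_r`, with commanded phase shifts `θ`. -/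
def overallChannel (s : State M N) (θ : Fin N → ℝ) : Fin M → ℂ :=
  s.1 + (Matrix.of s.2.1 *
    Matrix.diagonal fun i => Complex.exp (((θ i + s.2.2.2 i : ℝ) : ℂ) * Complex.I)).mulVec s.2.2.1

/-- `E{x xᴴ}` for a transmitted signal `x` of law `P`. -/
def inputCov (P : Measure (Fin M → ℂ)) : Matrix (Fin M) (Fin M) ℂ :=
  Matrix.of fun i j => ∫ x, x i * star (x j) ∂P

/-- Covariance `κ_b diag(E{x xᴴ})` of the distortion noise at the base station. -/
def System.bsDistortionCov (S : System) (P : Measure (Fin M → ℂ)) :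
    Matrix (Fin M) (Fin M) ℂ :=
  ((S.κb : ℝ) : ℂ) • Matrix.diagonal (inputCov P).diag

/-- Variance `κ_u hᴴ (E{x xᴴ} + Υ_B) h` of the distortion noise at the user, for the overall
channel `h`. -/
def System.userDistortionVar (S : System) (P : Measure (Fin M → ℂ)) (h : Fin M → ℂ) : ℝ≥0 :=
  S.κu * Real.toNNReal (dotProduct (star h) ((inputCov P + S.bsDistortionCov P).mulVec h)).re

/-- Law of `(η_b, η_u, n)`: independent circularly symmetric complex Gaussian distortion noise
at the base station, distortion noise at the user, and thermal noise. -/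
def System.noiseLaw (S : System) (P : Measure (Fin M → ℂ)) (h : Fin M → ℂ) :
    Measure ((Fin M → ℂ) × ℂ × ℂ) :=
  (Measure.pi fun i => cscg (Real.toNNReal (S.bsDistortionCov P i i).re)).prod
    ((cscg (S.userDistortionVar P h)).prod (cscg S.σ2))

/-- Joint law of the transmitted signal `x` and the received signal
`y = hᴴ (x + η_b) + η_u + n` when `x` has law `P` and the overall channel is `h`. -/
def System.inputOutputLaw (S : System) (P : Measure (Fin M → ℂ)) (h : Fin M → ℂ) :
    Measure ((Fin M → ℂ) × ℂ) :=
  (P.prod (S.noiseLaw P h)).map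
    (fun q => (q.1, dotProduct (star h) (q.1 + q.2.1) + q.2.2.1 + q.2.2.2))

/-- A transmission strategy of a base station that observes channel information in `B` and has
transmit power `pb`: the conditional law of the transmitted signal and the phase shifts of the
reflecting surface, both as functions of that information. -/
structure Strategy (M N : ℕ) (B : Type*) [MeasurableSpace B] (pb : ℝ≥0) where
  law : Kernel B (Fin M → ℂ)
  markov : IsMarkovKernel law
  power : ∀ b, ∫⁻ x, ∑ i, ‖x i‖ₑ ^ 2 ∂(law b) = pb
  phase : B → Fin N → ℝ
  phase_measurable : Measurable phase
  phase_mem : ∀ b i, phase b i ∈ Set.Icc 0 (2 * Real.pi)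

/-- Downlink capacity, in bits per channel use, when `csi` is the joint law of the actual state
and of the information about it that the base station and the user have: the supremum over the
strategies of the mean over the state and the information of the mutual information between `x`
and `y` given them, times the fraction of time spent on downlink data. -/
def System.capacity (S : System) {B U : Type*} [MeasurableSpace B] [MeasurableSpace U]
    (csi : Measure (State M N × B × U)) (pb : ℝ≥0) : ℝ≥0∞ :=
  ((S.τd / S.τ : ℝ≥0) : ℝ≥0∞) *
    ⨆ f : Strategy M N B pb,
      ∫⁻ ω, mutualInfo (S.inputOutputLaw (f.law ω.2.1)
        (overallChannel ω.1 (f.phase ω.2.1))) ∂csi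

/-- Average power consumed for the downlink, circuit power included. -/
def System.downlinkPower (S : System) (M : ℕ) (pb pu : ℝ≥0) : ℝ≥0 :=
  S.τd / (S.τu + S.τd) * (S.τpilot * pu / S.τ + M * S.ρ + S.ζ) + S.τd * pb / S.τ

/-- Downlink energy efficiency. -/
def System.energyEfficiency (S : System) {B U : Type*} [MeasurableSpace B] [MeasurableSpace U]
    (csi : Measure (State M N × B × U)) (pb pu : ℝ≥0) : ℝ≥0∞ :=
  S.capacity csi pb / (S.downlinkPower M pb pu : ℝ≥0∞)

/-- The channel information available in each configuration: for `M` antennas, `N` reflecting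
elements and transmit powers `pb`, `pu`, the joint law of the actual state, the information of
the base station and the information of the user. -/
structure System.ChannelInfo (S : System) (B U : ℕ → ℕ → Type*)
    [∀ M N, MeasurableSpace (B M N)] [∀ M N, MeasurableSpace (U M N)] where
  joint : (M N : ℕ) → (pb pu : ℝ≥0) → Measure (State M N × B M N × U M N)
  fst_joint : ∀ M N pb pu, (joint M N pb pu).fst = S.stateLaw M N

/-- Maximal (supremal) energy efficiency with `M` antennas, over both transmit powers and the
number of reflecting elements. -/
def System.maxEfficiencyAt (S : System) {B U : ℕ → ℕ → Type*}
    [∀ M N, MeasurableSpace (B M N)] [∀ M N, MeasurableSpace (U M N)]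
    (C : S.ChannelInfo B U) (M : ℕ) : ℝ≥0∞ :=
  ⨆ (N : ℕ) (pb : ℝ≥0) (pu : ℝ≥0), S.energyEfficiency (C.joint M N pb pu) pb pu

/-- Maximal (supremal) energy efficiency, over both transmit powers, the number of antennas and
the number of reflecting elements. -/
def System.maxEfficiency (S : System) {B U : ℕ → ℕ → Type*}
    [∀ M N, MeasurableSpace (B M N)] [∀ M N, MeasurableSpace (U M N)]
    (C : S.ChannelInfo B U) : ℝ≥0∞ :=
  ⨆ M : ℕ, S.maxEfficiencyAt C M

/-- `log₂(1 + 1/(κ_b + κ_u(1 + κ_b))) / (τ ζ / (τ_u + τ_d))` -/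
def System.lowerBound (S : System) : ℝ :=
  Real.logb 2 (1 + 1 / ((S.κb : ℝ) + S.κu * (1 + S.κb))) / ((S.τ : ℝ) * S.ζ / (S.τu + S.τd))

/-- `log₂(1 + 1/κ_u) / (τ ζ / (τ_u + τ_d))` -/
def System.upperBound (S : System) : ℝ :=
  Real.logb 2 (1 + 1 / (S.κu : ℝ)) / ((S.τ : ℝ) * S.ζ / (S.τu + S.τd))

end IRS

end

/-! Given the overall channel h, the link is an additive Gaussian noise channel with signal s = hᴴx.
With E = 𝔼|s|² and D = ∑ |h_i|² 𝔼|x_i|², its noise variance is v = κ_b D + κ_u (E + κ_b D) + σ²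
(`System.coe_noiseVar`).

Upper bound. The mutual information is at most log₂(1 + E/v) (`mutualInfo_awgnLaw_le`), and v ≥ κ_u
E, so it is at most log₂(1 + 1/κ_u) for every input, channel and channel information. The consumed
power is at least its circuit part, which grows linearly in M when ρ > 0. This gives the upper bound
and the decay in M; a sequence tending to the least element attains its supremum.

Lower bound, ρ = 0. An isotropic Gaussian input that ignores the channel information has E = D = a,
hence SNR a / (aκ + σ²) with κ = κ_b + κ_u(1 + κ_b), which increases to 1/κ with a. Antennas cost
nothing, so it suffices to make a large while the total power x is small. Here a = x‖h‖²/M. By the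
law of large numbers over the antennas, ‖h‖²/M concentrates at a level of at least the order of N
(`System.exists_stateLaw_gain_le`), so it exceeds 1/x² with probability at least 1 - x for suitable
M and N. Then a > 1/x, and x → 0 gives the bound. -/

namespace IRS

/-! ### Circularly symmetric complex Gaussian laws -/

lemma cscg_eq_map (v : ℝ≥0) : cscg v =
    ((gaussianReal 0 (v / 2)).prod (gaussianReal 0 (v / 2))).map
      Complex.measurableEquivRealProd.symm := rfl

instance isProbabilityMeasure_cscg (v : ℝ≥0) : IsProbabilityMeasure (cscg v) := by
  rw [cscg_eq_map]
  exact Measure.isProbabilityMeasure_map (MeasurableEquiv.measurable _).aemeasurable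

lemma map_re_cscg (v : ℝ≥0) : (cscg v).map Complex.re = gaussianReal 0 (v / 2) := by
  rw [cscg_eq_map, Measure.map_map Complex.measurable_re (MeasurableEquiv.measurable _)]
  exact Measure.map_fst_prod.trans (by simp)

lemma map_im_cscg (v : ℝ≥0) : (cscg v).map Complex.im = gaussianReal 0 (v / 2) := by
  rw [cscg_eq_map, Measure.map_map Complex.measurable_im (MeasurableEquiv.measurable _)]
  exact Measure.map_snd_prod.trans (by simp)

lemma memLp_re_cscg (v : ℝ≥0) : MemLp Complex.re 2 (cscg v) := by
  have h := memLp_id_gaussianReal (μ := 0) (v := v / 2) 2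
  rw [← map_re_cscg] at h
  exact (memLp_map_measure_iff (by fun_prop) Complex.measurable_re.aemeasurable).1 h

lemma memLp_im_cscg (v : ℝ≥0) : MemLp Complex.im 2 (cscg v) := by
  have h := memLp_id_gaussianReal (μ := 0) (v := v / 2) 2
  rw [← map_im_cscg] at h
  exact (memLp_map_measure_iff (by fun_prop) Complex.measurable_im.aemeasurable).1 h

lemma integral_re_cscg (v : ℝ≥0) : ∫ z, z.re ∂(cscg v) = 0 := by
  have h := integral_map (μ := cscg v) Complex.measurable_re.aemeasurable
    (f := fun x : ℝ => x) (by fun_prop)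
  rw [← h, map_re_cscg, integral_id_gaussianReal]

lemma integral_im_cscg (v : ℝ≥0) : ∫ z, z.im ∂(cscg v) = 0 := by
  have h := integral_map (μ := cscg v) Complex.measurable_im.aemeasurable
    (f := fun x : ℝ => x) (by fun_prop)
  rw [← h, map_im_cscg, integral_id_gaussianReal]

lemma integral_sq_gaussianReal (v : ℝ≥0) : ∫ x, x ^ 2 ∂(gaussianReal 0 v) = v := by
  have h := variance_id_gaussianReal (μ := 0) (v := v)
  rw [variance_of_integral_eq_zero (by fun_prop) (by simp [integral_id_gaussianReal])] at h
  simpa using h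

lemma integral_re_sq_cscg (v : ℝ≥0) : ∫ z, z.re ^ 2 ∂(cscg v) = v / 2 := by
  have h := integral_map (μ := cscg v) Complex.measurable_re.aemeasurable
    (f := fun x : ℝ => x ^ 2) (by fun_prop)
  rw [← h, map_re_cscg, integral_sq_gaussianReal]
  simp

lemma integral_im_sq_cscg (v : ℝ≥0) : ∫ z, z.im ^ 2 ∂(cscg v) = v / 2 := by
  have h := integral_map (μ := cscg v) Complex.measurable_im.aemeasurable
    (f := fun x : ℝ => x ^ 2) (by fun_prop)
  rw [← h, map_im_cscg, integral_sq_gaussianReal]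
  simp

lemma normSq_eq (z : ℂ) : ‖z‖ ^ 2 = z.re ^ 2 + z.im ^ 2 := by
  rw [Complex.sq_norm, Complex.normSq_apply]; ring

lemma integrable_normSq_cscg (v : ℝ≥0) : Integrable (fun z : ℂ => ‖z‖ ^ 2) (cscg v) := by
  simp_rw [normSq_eq]
  exact (memLp_re_cscg v).integrable_sq.add (memLp_im_cscg v).integrable_sq

lemma integral_normSq_cscg (v : ℝ≥0) : ∫ z, ‖z‖ ^ 2 ∂(cscg v) = v := by
  simp_rw [normSq_eq]
  rw [integral_add (memLp_re_cscg v).integrable_sq (memLp_im_cscg v).integrable_sq,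
    integral_re_sq_cscg, integral_im_sq_cscg]
  ring

/-- Density of `cscg v` with respect to Lebesgue measure. -/
noncomputable def cscgPDF (v : ℝ≥0) (z : ℂ) : ℝ≥0∞ :=
  ENNReal.ofReal ((Real.pi * v)⁻¹ * Real.exp (-‖z‖ ^ 2 / v))

lemma measurable_cscgPDF (v : ℝ≥0) : Measurable (cscgPDF v) := by
  unfold cscgPDF; fun_prop

lemma cscg_eq_withDensity {v : ℝ≥0} (hv : v ≠ 0) : cscg v = volume.withDensity (cscgPDF v) := by
  have hv2 : v / 2 ≠ 0 := by simpa using hv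
  have hmp := Complex.volume_preserving_equiv_real_prod.symm
  have hm := measurable_gaussianPDF 0 (v / 2)
  rw [cscg_eq_map, gaussianReal_of_var_ne_zero _ hv2, prod_withDensity hm hm]
  refine Measure.ext_of_lintegral _ fun f hf => ?_
  rw [lintegral_map hf (MeasurableEquiv.measurable _),
    lintegral_withDensity_eq_lintegral_mul _ (by fun_prop)
      (show Measurable fun p => f (Complex.measurableEquivRealProd.symm p) from
        hf.comp (MeasurableEquiv.measurable _)),
    lintegral_withDensity_eq_lintegral_mul _ (measurable_cscgPDF v) hf,
    ← hmp.lintegral_comp ((measurable_cscgPDF v).mul hf)]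
  refine lintegral_congr fun p => ?_
  simp only [Pi.mul_apply]
  congr 1
  have hv0 : (0 : ℝ) < v := by positivity
  rw [gaussianPDF, gaussianPDF, ← ENNReal.ofReal_mul (gaussianPDFReal_nonneg _ _ _), cscgPDF]
  congr 1
  rw [normSq_eq]
  simp only [gaussianPDFReal, Complex.measurableEquivRealProd_symm_apply, sub_zero,
    NNReal.coe_div, NNReal.coe_ofNat]
  have h1 : 2 * Real.pi * ((v : ℝ) / 2) = Real.pi * v := by ring
  have h2 : 2 * ((v : ℝ) / 2) = v := by ring
  rw [h1, h2, mul_mul_mul_comm, ← Real.exp_add, ← mul_inv, Real.mul_self_sqrt (by positivity)]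
  congr 2
  ring

/-- The stability properties of `cscg` below all follow from uniqueness of characteristic functions.
The 4 arises because each coordinate has variance v / 2. -/
lemma charFun_cscg (v : ℝ≥0) (t : ℂ) :
    charFun (cscg v) t = Complex.exp (-(v * ‖t‖ ^ 2 / 4 : ℝ)) := by
  rw [charFun_apply, cscg_eq_map, integral_map_equiv]
  have h : ∀ p : ℝ × ℝ, Complex.exp
      ((inner ℝ (Complex.measurableEquivRealProd.symm p) t : ℝ) * Complex.I) =
      Complex.exp ((inner ℝ p.1 t.re : ℝ) * Complex.I) *
        Complex.exp ((inner ℝ p.2 t.im : ℝ) * Complex.I) := by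
    intro p
    rw [← Complex.exp_add]
    congr 1
    simp [Complex.inner]
    ring
  simp_rw [h]
  rw [integral_prod_mul (f := fun x : ℝ => Complex.exp ((inner ℝ x t.re : ℝ) * Complex.I))
    (g := fun x : ℝ => Complex.exp ((inner ℝ x t.im : ℝ) * Complex.I)), ← charFun_apply,
    ← charFun_apply, charFun_gaussianReal, charFun_gaussianReal, ← Complex.exp_add, normSq_eq]
  congr 1
  push_cast
  ring

/-- The factor c passes to t as its conjugate, and the characteristic function sees only the norm of
its argument: this is circular symmetry. -/
lemma map_mul_cscg (c : ℂ) (v : ℝ≥0) : (cscg v).map (c * ·) = cscg (‖c‖₊ ^ 2 * v) := by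
  have : IsProbabilityMeasure ((cscg v).map (c * ·)) :=
    Measure.isProbabilityMeasure_map (by fun_prop)
  refine Measure.ext_of_charFun (funext fun t => ?_)
  rw [charFun_apply, integral_map (by fun_prop) (by fun_prop)]
  have h : ∀ z : ℂ, inner ℝ (c * z) t = inner ℝ z (star c * t) := fun z => by
    simp [Complex.inner]; ring
  simp_rw [h]
  rw [← charFun_apply, charFun_cscg, charFun_cscg]
  simp
  ring_nf

lemma cscg_conv (a b : ℝ≥0) : (cscg a).conv (cscg b) = cscg (a + b) := by
  refine Measure.ext_of_charFun (funext fun t => ?_)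
  rw [charFun_conv, charFun_cscg, charFun_cscg, charFun_cscg, ← Complex.exp_add]
  congr 1
  push_cast
  ring

lemma map_dotProduct_pi_cscg {M : ℕ} (c : Fin M → ℂ) (v : Fin M → ℝ≥0) :
    (Measure.pi fun i => cscg (v i)).map (fun x => dotProduct c x) =
      cscg (∑ i, ‖c i‖₊ ^ 2 * v i) := by
  have hm : Measurable fun x : Fin M → ℂ => dotProduct c x := by
    unfold dotProduct; fun_prop
  have : IsProbabilityMeasure ((Measure.pi fun i => cscg (v i)).map (fun x => dotProduct c x)) :=
    Measure.isProbabilityMeasure_map hm.aemeasurable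
  refine Measure.ext_of_charFun (funext fun t => ?_)
  rw [charFun_apply, integral_map hm.aemeasurable (by fun_prop)]
  have h : ∀ x : Fin M → ℂ, Complex.exp ((inner ℝ (dotProduct c x) t : ℝ) * Complex.I) =
      ∏ i, Complex.exp ((inner ℝ (c i * x i) t : ℝ) * Complex.I) := fun x => by
    rw [← Complex.exp_sum, ← Finset.sum_mul, ← Complex.ofReal_sum, ← sum_inner]
    rfl
  simp_rw [h]
  rw [integral_fintype_prod_eq_prod
    (f := fun i (z : ℂ) => Complex.exp ((inner ℝ (c i * z) t : ℝ) * Complex.I))]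
  have h2 : ∀ i, ∫ z, Complex.exp ((inner ℝ (c i * z) t : ℝ) * Complex.I) ∂(cscg (v i)) =
      Complex.exp (-((‖c i‖₊ ^ 2 * v i : ℝ≥0) * ‖t‖ ^ 2 / 4 : ℝ)) := fun i => by
    rw [← charFun_cscg, ← map_mul_cscg, charFun_apply, integral_map (by fun_prop) (by fun_prop)]
  simp_rw [h2]
  rw [charFun_cscg, ← Complex.exp_sum]
  congr 1
  push_cast
  rw [Finset.sum_neg_distrib, Finset.sum_mul, Finset.sum_div]

/-! ### Mutual information over an additive Gaussian noise channel -/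

open InformationTheory in
lemma klDiv_map_swap {α β : Type*} [MeasurableSpace α] [MeasurableSpace β]
    (μ ν : Measure (α × β)) [IsFiniteMeasure μ] [IsFiniteMeasure ν] :
    klDiv (μ.map Prod.swap) (ν.map Prod.swap) = klDiv μ ν := by
  refine le_antisymm (klDiv_map_le _ _ measurable_swap) ?_
  have h := klDiv_map_le (μ.map Prod.swap) (ν.map Prod.swap) measurable_swap
  simpa [Measure.map_map measurable_swap measurable_swap] using h

open InformationTheory in
/-- The product of the marginals minimizes the relative entropy among the product measures with
a given first marginal. -/
lemma klDiv_prod_snd_le {α β : Type*} [MeasurableSpace α] [StandardBorelSpace α] [Nonempty α]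
    [MeasurableSpace β] (J : Measure (α × β)) [IsProbabilityMeasure J] (P : Measure α)
    [IsProbabilityMeasure P] (G : Measure β) [IsProbabilityMeasure G] :
    klDiv J (P.prod J.snd) ≤ klDiv J (P.prod G) := by
  -- The marginal that varies must come first for the chain rule of relative entropy to apply.
  rw [← klDiv_map_swap, ← klDiv_map_swap J (P.prod G), Measure.prod_swap, Measure.prod_swap]
  set K := J.map Prod.swap with hK
  have : IsProbabilityMeasure K := Measure.isProbabilityMeasure_map (by fun_prop)
  have hfst : J.snd = K.fst := by
    rw [Measure.snd, Measure.fst, hK, Measure.map_map measurable_fst measurable_swap]; rfl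
  have hdis : K.fst ⊗ₘ K.condKernel = K := K.disintegrate K.condKernel
  rw [hfst]
  calc klDiv K (K.fst.prod P)
      = klDiv (K.fst ⊗ₘ K.condKernel) (K.fst ⊗ₘ Kernel.const β P) := by
        rw [hdis, Measure.compProd_const]
    -- The price of replacing the true output law by G is exactly the relative entropy of the output
    -- law to G.
    _ ≤ klDiv K.fst G + klDiv (K.fst ⊗ₘ K.condKernel) (K.fst ⊗ₘ Kernel.const β P) := le_add_self
    _ = klDiv (K.fst ⊗ₘ K.condKernel) (G ⊗ₘ Kernel.const β P) :=
        (klDiv_compProd_eq_add _ _ _ _).symm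
    _ = klDiv K (G.prod P) := by rw [hdis, Measure.compProd_const]

/-- Joint law of the input and the output of the channel `x ↦ s x + z` with noise `z` of law
`cscg v`. -/
noncomputable def awgnLaw {α : Type*} [MeasurableSpace α] (P : Measure α) (s : α → ℂ) (v : ℝ≥0) :
    Measure (α × ℂ) :=
  (P.prod (cscg v)).map fun p => (p.1, s p.1 + p.2)

section Llr

variable {α : Type*} {s : α → ℂ} {v w : ℝ≥0}

/-- Log-likelihood ratio between `awgnLaw P s v` and `P.prod (cscg w)`. -/
noncomputable def awgnLlr (s : α → ℂ) (v w : ℝ≥0) (p : α × ℂ) : ℝ :=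
  Real.log (w / v) - ‖p.2 - s p.1‖ ^ 2 / v + ‖p.2‖ ^ 2 / w

lemma cscgPDF_mul_exp_awgnLlr (hv : v ≠ 0) (hw : w ≠ 0) (x : α) (y : ℂ) :
    cscgPDF w y * ENNReal.ofReal (Real.exp (awgnLlr s v w (x, y))) = cscgPDF v (y - s x) := by
  have hv0 : (0 : ℝ) < v := by positivity
  have hw0 : (0 : ℝ) < w := by positivity
  rw [cscgPDF, cscgPDF, ← ENNReal.ofReal_mul (by positivity), awgnLlr]
  congr 1
  simp only
  rw [Real.exp_add, Real.exp_sub, Real.exp_log (by positivity), neg_div, neg_div, Real.exp_neg,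
    Real.exp_neg]
  field_simp

lemma awgnLlr_comp (p : α × ℂ) : awgnLlr s v w (p.1, s p.1 + p.2) =
    Real.log (w / v) - ‖p.2‖ ^ 2 / v + (‖s p.1‖ ^ 2 + ‖p.2‖ ^ 2 +
      2 * ((s p.1).re * p.2.re + (s p.1).im * p.2.im)) / w := by
  simp only [awgnLlr, add_sub_cancel_left, normSq_eq, Complex.add_re, Complex.add_im]
  ring

end Llr

section Awgn

variable {α : Type*} [MeasurableSpace α] {P : Measure α} {s : α → ℂ} {v w : ℝ≥0}

lemma measurable_awgn (hs : Measurable s) :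
    Measurable fun p : α × ℂ => (p.1, s p.1 + p.2) := by fun_prop

lemma fst_awgnLaw (hs : Measurable s) : (awgnLaw P s v).fst = P := by
  rw [Measure.fst, awgnLaw, Measure.map_map measurable_fst (measurable_awgn hs)]
  exact Measure.map_fst_prod.trans (by simp)

lemma measurable_awgnLlr (hs : Measurable s) : Measurable (awgnLlr s v w) := by
  unfold awgnLlr; fun_prop

lemma awgnLaw_eq_withDensity (hs : Measurable s) (hv : v ≠ 0) (hw : w ≠ 0) :
    awgnLaw P s v = (P.prod (cscg w)).withDensity
      fun p => ENNReal.ofReal (Real.exp (awgnLlr s v w p)) := by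
  have hl := measurable_awgnLlr (v := v) (w := w) hs
  have hd : Measurable fun p => ENNReal.ofReal (Real.exp (awgnLlr s v w p)) := by fun_prop
  refine Measure.ext_of_lintegral _ fun f hf => ?_
  rw [awgnLaw, lintegral_map hf (measurable_awgn hs),
    lintegral_withDensity_eq_lintegral_mul _ hd hf,
    lintegral_prod (fun p => f (p.1, s p.1 + p.2)) (hf.comp (measurable_awgn hs)).aemeasurable,
    lintegral_prod _ (hd.mul hf).aemeasurable]
  refine lintegral_congr fun x => ?_
  rw [cscg_eq_withDensity hv, cscg_eq_withDensity hw,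
    lintegral_withDensity_eq_lintegral_mul _ (measurable_cscgPDF v) (by fun_prop),
    lintegral_withDensity_eq_lintegral_mul _ (measurable_cscgPDF w) (by fun_prop),
    -- Translation by s x turns the noise density into the density of the output given x.
    ← lintegral_sub_right_eq_self _ (s x)]
  refine lintegral_congr fun y => ?_
  simp only [Pi.mul_apply, add_sub_cancel]
  rw [← mul_assoc, cscgPDF_mul_exp_awgnLlr hv hw]

variable [IsProbabilityMeasure P]

lemma isProbabilityMeasure_awgnLaw (hs : Measurable s) (v : ℝ≥0) :
    IsProbabilityMeasure (awgnLaw P s v) :=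
  Measure.isProbabilityMeasure_map (measurable_awgn hs).aemeasurable

lemma snd_awgnLaw (hs : Measurable s) : (awgnLaw P s v).snd = (P.map s).conv (cscg v) := by
  rw [Measure.snd, awgnLaw, Measure.map_map measurable_snd (measurable_awgn hs), Measure.conv]
  have h : (P.map s).prod (cscg v) = (P.prod (cscg v)).map (Prod.map s id) := by
    rw [← Measure.map_prod_map _ _ hs measurable_id, Measure.map_id]
  rw [h, Measure.map_map (by fun_prop) (by fun_prop)]
  rfl

/-- The cross terms vanish because the noise is centred and independent of the signal; the signal
need not be centred. Leaving v / v unreduced keeps the formula valid for v = 0. -/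
lemma integral_awgnLlr (hs : Measurable s) (hs2 : MemLp s 2 P) :
    Integrable (awgnLlr s v w) (awgnLaw P s v) ∧
    ∫ p, awgnLlr s v w p ∂(awgnLaw P s v) =
      Real.log (w / v) - v / v + (∫ x, ‖s x‖ ^ 2 ∂P + v) / w := by
  have hl := measurable_awgnLlr (v := v) (w := w) hs
  have i1 : Integrable (fun p : α × ℂ => ‖p.2‖ ^ 2) (P.prod (cscg v)) :=
    (integrable_normSq_cscg v).comp_snd P
  have i2 : Integrable (fun p : α × ℂ => ‖s p.1‖ ^ 2) (P.prod (cscg v)) :=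
    (hs2.integrable_norm_pow (by norm_num)).comp_fst (cscg v)
  have s1 : Integrable s P := hs2.integrable (by norm_num)
  have i3 : Integrable (fun p : α × ℂ => (s p.1).re * p.2.re) (P.prod (cscg v)) :=
    s1.re.mul_prod ((memLp_re_cscg v).integrable (by norm_num))
  have i4 : Integrable (fun p : α × ℂ => (s p.1).im * p.2.im) (P.prod (cscg v)) :=
    s1.im.mul_prod ((memLp_im_cscg v).integrable (by norm_num))
  have i5 := (i3.add i4).const_mul 2
  have i6 := (i2.add i1).add i5
  have i7 := (integrable_const (μ := P.prod (cscg v)) (Real.log (w / v))).sub (i1.div_const v)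
  constructor
  · rw [awgnLaw, integrable_map_measure hl.aestronglyMeasurable (measurable_awgn hs).aemeasurable]
    refine (i7.add (i6.div_const w)).congr (ae_of_all _ fun p => ?_)
    simp only [Function.comp, awgnLlr_comp]
    rfl
  · rw [awgnLaw, integral_map (measurable_awgn hs).aemeasurable hl.aestronglyMeasurable]
    simp only [awgnLlr_comp]
    have e1 : ∫ p : α × ℂ, ‖p.2‖ ^ 2 ∂(P.prod (cscg v)) = v := by
      rw [integral_fun_snd (fun z : ℂ => ‖z‖ ^ 2), integral_normSq_cscg]; simp
    have e2 : ∫ p : α × ℂ, ‖s p.1‖ ^ 2 ∂(P.prod (cscg v)) = ∫ x, ‖s x‖ ^ 2 ∂P := by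
      rw [integral_fun_fst (fun x => ‖s x‖ ^ 2)]; simp
    have e3 : ∫ p : α × ℂ, (s p.1).re * p.2.re ∂(P.prod (cscg v)) = 0 := by
      rw [integral_prod_mul (fun x => (s x).re) (fun z : ℂ => z.re), integral_re_cscg, mul_zero]
    have e4 : ∫ p : α × ℂ, (s p.1).im * p.2.im ∂(P.prod (cscg v)) = 0 := by
      rw [integral_prod_mul (fun x => (s x).im) (fun z : ℂ => z.im), integral_im_cscg, mul_zero]
    refine (integral_add i7 (i6.div_const w)).trans ?_
    congr 1
    · refine (integral_sub (integrable_const _) (i1.div_const v)).trans ?_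
      rw [integral_div, e1]; simp
    · rw [integral_div]
      congr 1
      refine (integral_add (i2.add i1) i5).trans ?_
      rw [integral_const_mul]
      have := integral_add i3 i4
      simp only [Pi.add_apply] at this ⊢
      rw [this, integral_add i2 i1, e1, e2, e3, e4]
      ring

open InformationTheory in
-- When w is the second moment of the output, the two quadratic terms of the log-likelihood ratio
-- have means -1 and 1 and cancel.
lemma klDiv_awgnLaw (hs : Measurable s) (hs2 : MemLp s 2 P) (hv : v ≠ 0) (hw : w ≠ 0)
    (hsw : ∫ x, ‖s x‖ ^ 2 ∂P + v = w) :
    klDiv (awgnLaw P s v) (P.prod (cscg w)) = ENNReal.ofReal (Real.log (w / v)) := by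
  have := isProbabilityMeasure_awgnLaw (P := P) hs v
  have hl := measurable_awgnLlr (v := v) (w := w) hs
  have hv0 : (v : ℝ) ≠ 0 := by simpa using hv
  have hw0 : (w : ℝ) ≠ 0 := by simpa using hw
  obtain ⟨hint, hval⟩ := integral_awgnLlr (P := P) (v := v) (w := w) hs hs2
  have hJ := awgnLaw_eq_withDensity (P := P) hs hv hw
  have hac : awgnLaw P s v ≪ P.prod (cscg w) := by
    rw [hJ]; exact withDensity_absolutelyContinuous _ _
  have hllr : llr (awgnLaw P s v) (P.prod (cscg w)) =ᵐ[awgnLaw P s v] awgnLlr s v w := by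
    refine hac.ae_eq ?_
    have h := Measure.rnDeriv_withDensity (P.prod (cscg w))
      (f := fun p => ENNReal.ofReal (Real.exp (awgnLlr s v w p))) (by fun_prop)
    rw [← hJ] at h
    filter_upwards [h] with p hp
    rw [llr, hp, ENNReal.toReal_ofReal (Real.exp_pos _).le, Real.log_exp]
  rw [klDiv_of_ac_of_integrable hac (hint.congr hllr.symm), integral_congr_ae hllr, hval, hsw]
  simp [div_self hv0, div_self hw0]

/-- The mutual information over an additive Gaussian noise channel with a power constraint is at
most its Gaussian capacity. -/
lemma mutualInfo_awgnLaw_le [StandardBorelSpace α] [Nonempty α] (hs : Measurable s)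
    (hs2 : MemLp s 2 P) (hv : v ≠ 0) :
    mutualInfo (awgnLaw P s v) ≤ ENNReal.ofReal (Real.logb 2 (1 + (∫ x, ‖s x‖ ^ 2 ∂P) / v)) := by
  have := isProbabilityMeasure_awgnLaw (P := P) hs v
  have h0 : 0 ≤ ∫ x, ‖s x‖ ^ 2 ∂P := integral_nonneg fun _ => by positivity
  have hv0 : (0 : ℝ) < v := by positivity
  -- The reference output law is the Gaussian one with the second moment of the actual output.
  set w : ℝ≥0 := ⟨_, h0⟩ + v with hw
  have hwv : (w : ℝ) = ∫ x, ‖s x‖ ^ 2 ∂P + v := rfl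
  have hw0 : w ≠ 0 := (hv.bot_lt.trans_le le_add_self).ne'
  rw [mutualInfo, fst_awgnLaw hs, Real.logb, ENNReal.ofReal_div_of_pos (Real.log_pos one_lt_two)]
  refine ENNReal.div_le_div_right ((klDiv_prod_snd_le _ P (cscg w)).trans ?_) _
  rw [klDiv_awgnLaw hs hs2 hv hw0 hwv.symm, hwv, add_div, div_self hv0.ne', add_comm]

/-- A Gaussian received signal achieves the capacity of an additive Gaussian noise channel. -/
lemma mutualInfo_awgnLaw_of_gaussian (hs : Measurable s) (hv : v ≠ 0) {e : ℝ≥0}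
    (he : P.map s = cscg e) :
    mutualInfo (awgnLaw P s v) = ENNReal.ofReal (Real.logb 2 (1 + e / v)) := by
  have hv0 : (0 : ℝ) < v := by positivity
  have hs2 : MemLp s 2 P := by
    have h : MemLp id 2 (P.map s) := by
      rw [he, memLp_two_iff_integrable_sq_norm (by fun_prop)]
      exact integrable_normSq_cscg e
    exact (memLp_map_measure_iff (by fun_prop) hs.aemeasurable).1 h
  have hE : ∫ x, ‖s x‖ ^ 2 ∂P = e := by
    have h := integral_map (μ := P) hs.aemeasurable (f := fun z : ℂ => ‖z‖ ^ 2) (by fun_prop)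
    rw [← h, he, integral_normSq_cscg]
  rw [mutualInfo, fst_awgnLaw hs, snd_awgnLaw hs, he, cscg_conv,
    klDiv_awgnLaw hs hs2 hv (by simp [hv]) (by rw [hE]; rfl), Real.logb,
    ENNReal.ofReal_div_of_pos (Real.log_pos one_lt_two)]
  congr 3
  push_cast
  rw [add_div, div_self hv0.ne', add_comm]

end Awgn

/-! ### Weak law of large numbers for finite product measures -/

/-- Puts all the finite products on one probability space, where the strong law can be applied. -/
lemma map_infinitePi_fin {β : Type*} [MeasurableSpace β] (ν : Measure β) [IsProbabilityMeasure ν]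
    (n : ℕ) : (Measure.infinitePi fun _ : ℕ => ν).map (fun ω (i : Fin n) => ω i) =
      Measure.pi fun _ : Fin n => ν := by
  have h : iIndepFun (fun (i : ℕ) (ω : ℕ → β) => ω i) (Measure.infinitePi fun _ : ℕ => ν) :=
    iIndepFun_infinitePi (X := fun _ ω => ω) (fun _ => measurable_id)
  have h2 := h.precomp (g := fun i : Fin n => (i : ℕ)) Fin.val_injective
  rw [iIndepFun_iff_map_fun_eq_pi_map fun i => (measurable_pi_apply _).aemeasurable] at h2
  refine h2.trans ?_
  congr 1
  funext i
  exact Measure.infinitePi_map_eval _ _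

/-- The strong law gives convergence in measure of the averages, and an average at most K deviates
from the expectation by at least the fixed gap ∫ f - K. -/
lemma tendsto_measure_pi_sum_le {β : Type*} [MeasurableSpace β] {ν : Measure β}
    [IsProbabilityMeasure ν] {f : β → ℝ} (hf : Measurable f) (hfi : Integrable f ν) {K : ℝ}
    (hK : K < ∫ x, f x ∂ν) :
    Tendsto (fun n : ℕ => (Measure.pi fun _ : Fin n => ν) {x | ∑ i, f (x i) ≤ n * K})
      atTop (𝓝 0) := by
  set μ := Measure.infinitePi fun _ : ℕ => ν with hμ
  have hev : ∀ i, μ.map (fun ω => ω i) = ν := fun i => Measure.infinitePi_map_eval _ i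
  have hev' : ∀ i, MeasurePreserving (fun ω : ℕ → β => ω i) μ ν := fun i =>
    ⟨measurable_pi_apply i, hev i⟩
  have hfω : ∀ i, Measurable fun ω : ℕ → β => f (ω i) := fun i => by fun_prop
  have hind : iIndepFun (fun (i : ℕ) (ω : ℕ → β) => f (ω i)) μ :=
    iIndepFun_infinitePi (X := fun _ => f) (fun _ => hf)
  have hint0 : ∫ ω, f (ω 0) ∂μ = ∫ x, f x ∂ν := by
    rw [← hev 0, integral_map (measurable_pi_apply 0).aemeasurable (by fun_prop)]
  have hslln := strong_law_ae_real (μ := μ) (fun i ω => f (ω i))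
    ((hev' 0).integrable_comp_of_integrable hfi)
    (fun i j hij => hind.indepFun hij)
    (fun i => by
      refine ⟨(hfω i).aemeasurable, (hfω 0).aemeasurable, ?_⟩
      have h : ∀ j, μ.map (fun ω => f (ω j)) = ν.map f := fun j => by
        rw [← hev j, Measure.map_map hf (by fun_prop)]; rfl
      rw [h, h])
  rw [hint0] at hslln
  have hmeas := tendstoInMeasure_of_tendsto_ae
    (fun n => (by fun_prop : Measurable
      fun ω : ℕ → β => (∑ i ∈ Finset.range n, f (ω i)) / n).aestronglyMeasurable) hslln
  have ht := hmeas (ENNReal.ofReal (∫ x, f x ∂ν - K)) (by simpa using hK)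
  refine tendsto_of_tendsto_of_tendsto_of_le_of_le' tendsto_const_nhds ht
    (Eventually.of_forall fun _ => zero_le) ?_
  filter_upwards [eventually_gt_atTop 0] with n hn
  have hS : MeasurableSet {x : Fin n → β | ∑ i, f (x i) ≤ n * K} :=
    measurableSet_le (by fun_prop) (by fun_prop)
  rw [← map_infinitePi_fin ν n, Measure.map_apply (by fun_prop) hS]
  refine measure_mono fun ω hω => ?_
  simp only [Set.mem_preimage, Set.mem_ofPred_eq] at hω ⊢
  have hn0 : (0 : ℝ) < n := by exact_mod_cast hn
  rw [edist_dist, Real.dist_eq, abs_sub_comm]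
  refine ENNReal.ofReal_le_ofReal (le_trans ?_ (le_abs_self _))
  rw [Fin.sum_univ_eq_sum_range (fun i => f (ω i))] at hω
  have : (∑ i ∈ Finset.range n, f (ω i)) / n ≤ K := by
    rw [div_le_iff₀ hn0]; linarith
  linarith

/-! ### Hardening of the reflected channel -/

section Fading

variable {ν νd νg : Measure ℂ}

lemma IsFadingLaw.integrable_normSq (h : IsFadingLaw ν) : Integrable (fun z : ℂ => ‖z‖ ^ 2) ν :=
  h.memLp.integrable_norm_pow (by norm_num)

lemma IsFadingLaw.integrable (h : IsFadingLaw ν) : Integrable (fun z : ℂ => z) ν :=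
  have := h.prob
  h.memLp.integrable (by norm_num)

lemma memLp_re {β : Type*} [MeasurableSpace β] {μ : Measure β} {f : β → ℂ} (h : MemLp f 2 μ) :
    MemLp (fun x => (f x).re) 2 μ := h.re

lemma memLp_im {β : Type*} [MeasurableSpace β] {μ : Measure β} {f : β → ℂ} (h : MemLp f 2 μ) :
    MemLp (fun x => (f x).im) 2 μ := h.im

/-- Variances of independent variables add, and a variance is at most the second moment. -/
lemma sum_variance_le_integral_sq_pi {N : ℕ} {β : Type*} [MeasurableSpace β] {μ : Measure β}
    [IsProbabilityMeasure μ] (X : Fin N → β → ℝ) (hX : ∀ n, MemLp (X n) 2 μ)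
    (h0 : ∀ n, ∫ x, X n x ∂μ = 0) :
    ∑ n, ∫ x, X n x ^ 2 ∂μ ≤ ∫ g : Fin N → β, (∑ n, X n (g n)) ^ 2 ∂(Measure.pi fun _ => μ) := by
  have h := variance_sum_pi (μ := fun _ : Fin N => μ) hX
  have hm : MemLp (∑ n, fun g : Fin N → β => X n (g n)) 2 (Measure.pi fun _ => μ) := by
    refine memLp_finsetSum' _ fun n _ => ?_
    exact (hX n).comp_measurePreserving (measurePreserving_eval _ n)
  have h2 := variance_le_expectation_sq hm.aestronglyMeasurable
  rw [h] at h2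
  refine le_trans (le_of_eq ?_) (h2.trans (le_of_eq ?_))
  · refine Finset.sum_congr rfl fun n _ => ?_
    rw [variance_of_integral_eq_zero (hX n).aemeasurable (h0 n)]
  · simp [Finset.sum_apply]

lemma memLp_sum_mul (hg : IsFadingLaw νg) {N : ℕ} (c : Fin N → ℂ) :
    MemLp (fun g : Fin N → ℂ => ∑ n, g n * c n) 2 (Measure.pi fun _ => νg) := by
  have := hg.prob
  refine memLp_finsetSum _ fun n _ => ?_
  have h : MemLp (fun g : Fin N → ℂ => g n) 2 (Measure.pi fun _ => νg) :=
    hg.memLp.comp_measurePreserving (measurePreserving_eval (fun _ : Fin N => νg) n)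
  exact h.mul_const (c n)

/-- Real and imaginary parts of the sum are handled separately, so their correlation is irrelevant
and no circular symmetry of the law is needed. -/
lemma le_integral_normSq_sum (hg : IsFadingLaw νg) {N : ℕ} (c : Fin N → ℂ) :
    (∫ z, ‖z‖ ^ 2 ∂νg) * ∑ n, ‖c n‖ ^ 2 ≤
      ∫ g : Fin N → ℂ, ‖∑ n, g n * c n‖ ^ 2 ∂(Measure.pi fun _ => νg) := by
  have := hg.prob
  have hm : ∀ n, MemLp (fun z : ℂ => z * c n) 2 νg := fun n => hg.memLp.mul_const (c n)
  have h0 : ∀ n, ∫ z, z * c n ∂νg = 0 := fun n => by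
    rw [integral_mul_const, hg.mean_zero, zero_mul]
  have hi : ∀ n, Integrable (fun z : ℂ => z * c n) νg := fun n => hg.integrable.mul_const _
  have hre := sum_variance_le_integral_sq_pi (fun n z => (z * c n).re) (fun n => memLp_re (hm n))
    (fun n => (integral_re (hi n)).trans (by rw [h0]; rfl))
  have him := sum_variance_le_integral_sq_pi (fun n z => (z * c n).im) (fun n => memLp_im (hm n))
    (fun n => (integral_im (hi n)).trans (by rw [h0]; rfl))
  have hs := memLp_sum_mul hg c
  have e : ∀ n, ∫ z, (z * c n).re ^ 2 ∂νg + ∫ z, (z * c n).im ^ 2 ∂νg =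
      (∫ z, ‖z‖ ^ 2 ∂νg) * ‖c n‖ ^ 2 := fun n => by
    rw [← integral_add (memLp_re (hm n)).integrable_sq (memLp_im (hm n)).integrable_sq,
      ← integral_mul_const]
    refine integral_congr_ae (ae_of_all _ fun z => ?_)
    simp only
    rw [← normSq_eq, norm_mul, mul_pow]
  calc _ = ∑ n, (∫ z, (z * c n).re ^ 2 ∂νg + ∫ z, (z * c n).im ^ 2 ∂νg) := by
        simp_rw [e, Finset.mul_sum]
    _ ≤ _ := by
        rw [Finset.sum_add_distrib]
        refine (add_le_add hre him).trans (le_of_eq ?_)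
        have hs1 := memLp_re hs
        have hs2 := memLp_im hs
        simp only [Complex.re_sum, Complex.im_sum] at hs1 hs2
        rw [← integral_add hs1.integrable_sq hs2.integrable_sq]
        refine integral_congr_ae (ae_of_all _ fun g => ?_)
        simp only [normSq_eq, Complex.re_sum, Complex.im_sum]

/-- The direct path is centred and independent of the reflected one, so the cross term vanishes and
the direct path only adds power. -/
lemma integral_normSq_le_add {β : Type*} [MeasurableSpace β] {μ : Measure β}
    [IsProbabilityMeasure μ] (hd : IsFadingLaw νd) {X : β → ℂ} (hX : MemLp X 2 μ) :
    Integrable (fun p : ℂ × β => ‖p.1 + X p.2‖ ^ 2) (νd.prod μ) ∧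
      ∫ x, ‖X x‖ ^ 2 ∂μ ≤ ∫ p : ℂ × β, ‖p.1 + X p.2‖ ^ 2 ∂(νd.prod μ) := by
  have := hd.prob
  have hX1 : Integrable X μ := hX.integrable (by norm_num)
  have i1 : Integrable (fun p : ℂ × β => ‖p.1‖ ^ 2) (νd.prod μ) := hd.integrable_normSq.comp_fst μ
  have i2 : Integrable (fun p : ℂ × β => ‖X p.2‖ ^ 2) (νd.prod μ) :=
    (hX.integrable_norm_pow (by norm_num)).comp_snd νd
  have i3 : Integrable (fun p : ℂ × β => p.1.re * (X p.2).re) (νd.prod μ) :=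
    hd.integrable.re.mul_prod hX1.re
  have i4 : Integrable (fun p : ℂ × β => p.1.im * (X p.2).im) (νd.prod μ) :=
    hd.integrable.im.mul_prod hX1.im
  have e : ∀ p : ℂ × β, ‖p.1 + X p.2‖ ^ 2 =
      ‖p.1‖ ^ 2 + ‖X p.2‖ ^ 2 + 2 * (p.1.re * (X p.2).re + p.1.im * (X p.2).im) := fun p => by
    simp only [normSq_eq, Complex.add_re, Complex.add_im]; ring
  simp_rw [e]
  have i5 := (i3.add i4).const_mul 2
  refine ⟨(i1.add i2).add i5, ?_⟩
  have e3 : ∫ p : ℂ × β, p.1.re * (X p.2).re ∂(νd.prod μ) = 0 := by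
    rw [integral_prod_mul (fun z : ℂ => z.re) (fun x => (X x).re)]
    have h : ∫ z : ℂ, z.re ∂νd = 0 := (integral_re hd.integrable).trans (by
      rw [hd.mean_zero]; rfl)
    rw [h, zero_mul]
  have e4 : ∫ p : ℂ × β, p.1.im * (X p.2).im ∂(νd.prod μ) = 0 := by
    rw [integral_prod_mul (fun z : ℂ => z.im) (fun x => (X x).im)]
    have h : ∫ z : ℂ, z.im ∂νd = 0 := (integral_im hd.integrable).trans (by
      rw [hd.mean_zero]; rfl)
    rw [h, zero_mul]
  have key : ∫ p : ℂ × β, ‖p.1‖ ^ 2 + ‖X p.2‖ ^ 2 +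
      2 * (p.1.re * (X p.2).re + p.1.im * (X p.2).im) ∂(νd.prod μ) =
      ∫ z, ‖z‖ ^ 2 ∂νd + ∫ x, ‖X x‖ ^ 2 ∂μ := by
    refine (integral_add (i1.add i2) i5).trans ?_
    have h1 := integral_add i3 i4
    have h2 := integral_add i1 i2
    simp only [Pi.add_apply] at h1 h2 ⊢
    rw [integral_const_mul, h1, h2, e3, e4, integral_fun_snd (fun x => ‖X x‖ ^ 2),
      integral_fun_fst (fun z : ℂ => ‖z‖ ^ 2)]
    simp
  rw [key]
  have : 0 ≤ ∫ z, ‖z‖ ^ 2 ∂νd := integral_nonneg fun _ => by positivity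
  linarith

/-- Once the surface–user vector c is fixed, the antennas see i.i.d. coefficients, so the weak law
over M applies. -/
lemma tendsto_measure_channel_le (hd : IsFadingLaw νd) (hg : IsFadingLaw νg) {N : ℕ}
    (c : Fin N → ℂ) {K : ℝ} (hK : K < (∫ z, ‖z‖ ^ 2 ∂νg) * ∑ n, ‖c n‖ ^ 2) :
    Tendsto (fun M : ℕ => ((Measure.pi fun _ : Fin M => νd).prod
        (Measure.pi fun _ : Fin M => Measure.pi fun _ : Fin N => νg))
      {p | ∑ m, ‖p.1 m + ∑ n, p.2 m n * c n‖ ^ 2 ≤ M * K}) atTop (𝓝 0) := by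
  have := hd.prob
  have := hg.prob
  obtain ⟨hi, hle⟩ := integral_normSq_le_add (μ := Measure.pi fun _ : Fin N => νg) hd
    (memLp_sum_mul hg c)
  have h := tendsto_measure_pi_sum_le (by fun_prop) hi
    (hK.trans_le ((le_integral_normSq_sum hg c).trans hle))
  refine h.congr fun M => ?_
  have hmp := measurePreserving_arrowProdEquivProdArrow ℂ (Fin N → ℂ) (Fin M)
    (fun _ => νd) (fun _ => Measure.pi fun _ : Fin N => νg)
  rw [← hmp.measure_preimage (measurableSet_le (by fun_prop) (by fun_prop)).nullMeasurableSet]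
  rfl

end Fading

instance System.isProbabilityMeasure_stateLaw (S : System) (M N : ℕ) :
    IsProbabilityMeasure (S.stateLaw M N) := by
  have := S.νd_fading.prob
  have := S.νg_fading.prob
  have := S.νr_fading.prob
  have := S.phaseLaw_prob N
  unfold System.stateLaw
  infer_instance

lemma overallChannel_apply {M N : ℕ} (s : State M N) (θ : Fin N → ℝ) (m : Fin M) :
    overallChannel s θ m = s.1 m + ∑ n, s.2.1 m n *
      (Complex.exp (((θ n + s.2.2.2 n : ℝ) : ℂ) * Complex.I) * s.2.2.1 n) := by
  simp [overallChannel, Matrix.mulVec, dotProduct, Matrix.mul_diagonal, mul_assoc]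

lemma measurable_overallChannel {M N : ℕ} (θ : Fin N → ℝ) (m : Fin M) :
    Measurable fun s : State M N => overallChannel s θ m := by
  simp_rw [overallChannel_apply]
  fun_prop

/-- With enough antennas and enough reflecting elements, the mean gain of the overall channel per
antenna exceeds any given level with a probability close to one. -/
lemma System.exists_stateLaw_gain_le (S : System) (K : ℝ) {ε : ℝ≥0∞} (hε : 0 < ε) :
    ∃ M N : ℕ, 0 < M ∧
      S.stateLaw M N {s | ∑ m, ‖overallChannel s 0 m‖ ^ 2 ≤ M * K} ≤ ε := by
  have := S.νd_fading.prob
  have := S.νg_fading.prob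
  have := S.νr_fading.prob
  set σg := ∫ z, ‖z‖ ^ 2 ∂S.νg with hσg
  set σr := ∫ z, ‖z‖ ^ 2 ∂S.νr with hσr
  have hg0 : 0 < σg := S.νg_fading.var_pos
  have hr0 : 0 < σr := S.νr_fading.var_pos
  have hε2 : 0 < ε / 2 := ENNReal.half_pos hε.ne'
  have hr := tendsto_measure_pi_sum_le (by fun_prop) S.νr_fading.integrable_normSq
    (half_lt_self hr0)
  -- With probability close to one the norm squared of h_r exceeds N σr / 2; for such N the
  -- conditional mean gain then exceeds K.
  have hlarge : ∀ᶠ N : ℕ in atTop, K / (σg * (σr / 2)) ≤ N :=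
    tendsto_natCast_atTop_atTop.eventually_ge_atTop _
  obtain ⟨N, hN, hNK⟩ := ((hr.eventually_lt_const hε2).and hlarge).exists
  have := S.phaseLaw_prob N
  set ρ := (Measure.pi fun _ : Fin N => S.νr).prod (S.phaseLaw N) with hρ
  let c : (Fin N → ℂ) × (Fin N → ℝ) → Fin N → ℂ := fun q n =>
    Complex.exp (((0 + q.2 n : ℝ) : ℂ) * Complex.I) * q.1 n
  -- Phase factors have modulus one, so the law of the phase errors plays no role.
  have hc : ∀ q n, ‖c q n‖ = ‖q.1 n‖ := fun q n => by
    simp only [c, norm_mul, Complex.norm_exp_ofReal_mul_I, one_mul]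
  set A : Set ((Fin N → ℂ) × (Fin N → ℝ)) := {q | σg * ∑ n, ‖q.1 n‖ ^ 2 ≤ K} with hA
  have hAm : MeasurableSet A := measurableSet_le (by fun_prop) (by fun_prop)
  have hAε : ρ A < ε / 2 := by
    refine lt_of_le_of_lt ?_ hN
    have hsub : A ⊆ {r | ∑ i, ‖r i‖ ^ 2 ≤ N * (σr / 2)} ×ˢ Set.univ := by
      intro q hq
      refine ⟨?_, trivial⟩
      rw [hA, Set.mem_ofPred_eq] at hq
      rw [div_le_iff₀ (by positivity)] at hNK
      rw [Set.mem_ofPred_eq]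
      refine le_of_mul_le_mul_left (hq.trans (hNK.trans (le_of_eq ?_))) hg0
      ring
    refine (measure_mono hsub).trans (le_of_eq ?_)
    rw [hρ, Measure.prod_prod, measure_univ, mul_one]
  let μ : (M : ℕ) → Measure ((Fin M → ℂ) × (Fin M → Fin N → ℂ)) := fun M =>
    (Measure.pi fun _ : Fin M => S.νd).prod
      (Measure.pi fun _ : Fin M => Measure.pi fun _ : Fin N => S.νg)
  let T : (M : ℕ) → Set (((Fin M → ℂ) × (Fin M → Fin N → ℂ)) × (Fin N → ℂ) × (Fin N → ℝ)) :=
    fun M => {p | ∑ m, ‖p.1.1 m + ∑ n, p.1.2 m n * c p.2 n‖ ^ 2 ≤ M * K}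
  have hTm : ∀ M, MeasurableSet (T M) := fun M =>
    measurableSet_le (by fun_prop) (by fun_prop)
  let F : ℕ → (Fin N → ℂ) × (Fin N → ℝ) → ℝ≥0∞ := fun M q => μ M ((fun x => (x, q)) ⁻¹' T M)
  have hFm : ∀ M, Measurable (F M) := fun M => measurable_measure_prodMk_right (hTm M)
  have hF1 : ∀ M q, F M q ≤ 1 := fun M q => prob_le_one
  -- N is now fixed. Off A the conditional probability of a low gain tends to 0 as M grows,
  -- pointwise in q and bounded by 1.
  have hlim : Tendsto (fun M => ∫⁻ q in Aᶜ, F M q ∂ρ) atTop (𝓝 (∫⁻ _ in Aᶜ, 0 ∂ρ)) := by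
    refine tendsto_lintegral_of_dominated_convergence (fun _ => 1) hFm
      (fun M => ae_of_all _ (hF1 M)) (by simp) ?_
    filter_upwards [ae_restrict_mem hAm.compl] with q hq
    refine tendsto_measure_channel_le S.νd_fading S.νg_fading (c q) ?_
    simp_rw [hc]
    simpa [hA] using hq
  rw [lintegral_zero] at hlim
  obtain ⟨M, hM, hM0⟩ := ((hlim.eventually_lt_const hε2).and (eventually_gt_atTop 0)).exists
  refine ⟨M, N, hM0, ?_⟩
  have hmp : MeasurePreserving (MeasurableEquiv.prodAssoc :
      ((Fin M → ℂ) × (Fin M → Fin N → ℂ)) × (Fin N → ℂ) × (Fin N → ℝ) ≃ᵐ _)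
      ((μ M).prod ρ) (S.stateLaw M N) := measurePreserving_prodAssoc _ _ _
  have hTeq : S.stateLaw M N {s | ∑ m, ‖overallChannel s 0 m‖ ^ 2 ≤ M * K} =
      ((μ M).prod ρ) (T M) := by
    simp_rw [overallChannel_apply]
    rw [← hmp.measure_preimage (measurableSet_le (by fun_prop) (by fun_prop)).nullMeasurableSet]
    rfl
  rw [hTeq, Measure.prod_apply_symm (hTm M), ← lintegral_add_compl _ hAm, ← ENNReal.add_halves ε]
  refine add_le_add ?_ hM.le
  calc ∫⁻ q in A, F M q ∂ρ ≤ ∫⁻ _ in A, 1 ∂ρ := lintegral_mono fun q => hF1 M q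
    _ = ρ A := by simp
    _ ≤ ε / 2 := hAε.le

/-! ### The received signal as an additive Gaussian noise channel -/

section Link

variable {M : ℕ}

/-- Variance of the total noise in the received signal. -/
noncomputable def System.noiseVar (S : System) (P : Measure (Fin M → ℂ)) (h : Fin M → ℂ) : ℝ≥0 :=
  ∑ i, ‖h i‖₊ ^ 2 * Real.toNNReal (S.bsDistortionCov P i i).re +
    (S.userDistortionVar P h + S.σ2)

lemma System.noiseVar_ne_zero (S : System) (P : Measure (Fin M → ℂ)) (h : Fin M → ℂ) :
    S.noiseVar P h ≠ 0 :=
  (S.σ2_pos.trans_le (le_add_self.trans le_add_self)).ne'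

lemma measurable_dotProduct (h : Fin M → ℂ) : Measurable fun x : Fin M → ℂ => dotProduct h x := by
  unfold dotProduct; fun_prop

lemma System.map_noiseLaw (S : System) (P : Measure (Fin M → ℂ)) (h : Fin M → ℂ) :
    (S.noiseLaw P h).map (fun q => dotProduct (star h) q.1 + (q.2.1 + q.2.2)) =
      cscg (S.noiseVar P h) := by
  have hd := measurable_dotProduct (star h)
  have h1 := map_dotProduct_pi_cscg (star h) fun i => Real.toNNReal (S.bsDistortionCov P i i).re
  simp only [Pi.star_apply, nnnorm_star] at h1
  rw [System.noiseVar, ← cscg_conv, ← cscg_conv, ← h1, Measure.conv, Measure.conv,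
    Measure.map_prod_map _ _ hd (by fun_prop), Measure.map_map (by fun_prop) (by fun_prop)]
  rfl

lemma System.inputOutputLaw_eq_awgnLaw (S : System) (P : Measure (Fin M → ℂ))
    [IsProbabilityMeasure P] (h : Fin M → ℂ) :
    S.inputOutputLaw P h = awgnLaw P (fun x => dotProduct (star h) x) (S.noiseVar P h) := by
  have hd := measurable_dotProduct (star h)
  have : SFinite (S.noiseLaw P h) := by unfold System.noiseLaw; infer_instance
  have hm : Measurable fun q : (Fin M → ℂ) × ℂ × ℂ =>
    dotProduct (star h) q.1 + (q.2.1 + q.2.2) := by fun_prop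
  have hP : P.prod (cscg (S.noiseVar P h)) = (P.prod (S.noiseLaw P h)).map
      (Prod.map id fun q => dotProduct (star h) q.1 + (q.2.1 + q.2.2)) := by
    rw [← Measure.map_prod_map _ _ measurable_id hm, Measure.map_id, S.map_noiseLaw]
  rw [awgnLaw, hP, Measure.map_map (by fun_prop) (by fun_prop), System.inputOutputLaw]
  congr 1
  funext q
  simp [dotProduct_add, add_assoc]

lemma memLp_apply_of_power {P : Measure (Fin M → ℂ)} {p : ℝ≥0}
    (hP : ∫⁻ x, ∑ i, ‖x i‖ₑ ^ 2 ∂P = p) (i : Fin M) : MemLp (fun x => x i) 2 P := by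
  refine ⟨(measurable_pi_apply i).aestronglyMeasurable, ?_⟩
  rw [eLpNorm_lt_top_iff_lintegral_rpow_enorm_lt_top (by norm_num) (by norm_num)]
  refine lt_of_le_of_lt (lintegral_mono fun x => ?_) (hP.trans_lt ENNReal.coe_lt_top)
  simp only [ENNReal.toReal_ofNat, ENNReal.rpow_ofNat]
  exact Finset.single_le_sum (f := fun i => ‖x i‖ₑ ^ 2) (fun _ _ => zero_le) (Finset.mem_univ i)

variable {P : Measure (Fin M → ℂ)}

lemma memLp_dotProduct (hP : ∀ i, MemLp (fun x => x i) 2 P) (h : Fin M → ℂ) :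
    MemLp (fun x => dotProduct h x) 2 P :=
  memLp_finsetSum _ fun i _ => (hP i).const_mul (h i)

lemma inputCov_diag (i : Fin M) : inputCov P i i = ((∫ x, ‖x i‖ ^ 2 ∂P : ℝ) : ℂ) := by
  rw [inputCov, Matrix.of_apply, ← integral_complex_ofReal]
  refine integral_congr_ae (ae_of_all _ fun x => ?_)
  simp only [← starRingEnd_apply, Complex.mul_conj, Complex.normSq_eq_norm_sq]

lemma System.bsDistortionCov_diag (S : System) (i : Fin M) :
    S.bsDistortionCov P i i = ((S.κb * ∫ x, ‖x i‖ ^ 2 ∂P : ℝ) : ℂ) := by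
  rw [System.bsDistortionCov, Matrix.smul_apply, Matrix.diagonal_apply_eq, Matrix.diag_apply,
    inputCov_diag, smul_eq_mul, Complex.ofReal_mul]

lemma dotProduct_inputCov_mulVec (hP : ∀ i, MemLp (fun x => x i) 2 P) (h : Fin M → ℂ) :
    dotProduct (star h) ((inputCov P).mulVec h) =
      ((∫ x, ‖dotProduct (star h) x‖ ^ 2 ∂P : ℝ) : ℂ) := by
  have hi : ∀ i j, Integrable (fun x : Fin M → ℂ => x i * star (x j)) P := fun i j =>
    (hP i).integrable_mul (hP j).star
  rw [← integral_complex_ofReal]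
  have e : ∀ x : Fin M → ℂ, ((‖dotProduct (star h) x‖ ^ 2 : ℝ) : ℂ) =
      ∑ i, ∑ j, star (h i) * h j * (x i * star (x j)) := fun x => by
    rw [← Complex.normSq_eq_norm_sq, ← Complex.mul_conj, dotProduct, map_sum, Finset.sum_mul_sum]
    refine Finset.sum_congr rfl fun i _ => Finset.sum_congr rfl fun j _ => ?_
    simp
    ring
  simp_rw [e]
  rw [integral_finsetSum _ fun i _ => integrable_finsetSum _ fun j _ => (hi i j).const_mul _]
  rw [dotProduct]
  refine Finset.sum_congr rfl fun i _ => ?_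
  rw [integral_finsetSum _ fun j _ => (hi i j).const_mul _, Matrix.mulVec, dotProduct,
    Finset.mul_sum]
  refine Finset.sum_congr rfl fun j _ => ?_
  rw [integral_const_mul, inputCov, Matrix.of_apply, Pi.star_apply]
  ring

lemma System.dotProduct_bsDistortionCov_mulVec (S : System) (h : Fin M → ℂ) :
    dotProduct (star h) ((S.bsDistortionCov P).mulVec h) =
      ((S.κb * ∑ i, ‖h i‖ ^ 2 * ∫ x, ‖x i‖ ^ 2 ∂P : ℝ) : ℂ) := by
  rw [System.bsDistortionCov, Matrix.smul_mulVec, dotProduct_smul, dotProduct]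
  push_cast
  rw [smul_eq_mul]
  congr 1
  refine Finset.sum_congr rfl fun i _ => ?_
  rw [Matrix.mulVec_diagonal, Matrix.diag_apply, inputCov_diag, Pi.star_apply, mul_left_comm,
    ← starRingEnd_apply, mul_comm (starRingEnd ℂ (h i)), Complex.mul_conj,
    Complex.normSq_eq_norm_sq, mul_comm]
  push_cast
  rfl

lemma System.coe_noiseVar (S : System) (hP : ∀ i, MemLp (fun x => x i) 2 P) (h : Fin M → ℂ) :
    (S.noiseVar P h : ℝ) = S.κb * ∑ i, ‖h i‖ ^ 2 * ∫ x, ‖x i‖ ^ 2 ∂P +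
      (S.κu * (∫ x, ‖dotProduct (star h) x‖ ^ 2 ∂P +
        S.κb * ∑ i, ‖h i‖ ^ 2 * ∫ x, ‖x i‖ ^ 2 ∂P) + S.σ2) := by
  have hpos : ∀ i, 0 ≤ ∫ x, ‖x i‖ ^ 2 ∂P := fun i => integral_nonneg fun _ => by positivity
  have hE : 0 ≤ ∫ x, ‖dotProduct (star h) x‖ ^ 2 ∂P := integral_nonneg fun _ => by positivity
  have hD : 0 ≤ ∑ i, ‖h i‖ ^ 2 * ∫ x, ‖x i‖ ^ 2 ∂P :=
    Finset.sum_nonneg fun i _ => mul_nonneg (by positivity) (hpos i)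
  rw [System.noiseVar, System.userDistortionVar, Matrix.add_mulVec, dotProduct_add,
    dotProduct_inputCov_mulVec hP, S.dotProduct_bsDistortionCov_mulVec, ← Complex.ofReal_add,
    Complex.ofReal_re]
  push_cast
  -- The truncations in the definitions of the variances act on nonnegative numbers only.
  rw [Real.coe_toNNReal _ (by positivity)]
  congr 1
  rw [Finset.mul_sum]
  refine Finset.sum_congr rfl fun i _ => ?_
  rw [S.bsDistortionCov_diag, Complex.ofReal_re,
    Real.coe_toNNReal _ (by have := hpos i; positivity)]
  ring

/-- Distortion noise at the user limits the mutual information, whatever the input and the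
channel are. -/
lemma System.mutualInfo_inputOutputLaw_le (S : System) [IsProbabilityMeasure P]
    (hP : ∀ i, MemLp (fun x => x i) 2 P) (h : Fin M → ℂ) :
    mutualInfo (S.inputOutputLaw P h) ≤ ENNReal.ofReal (Real.logb 2 (1 + 1 / S.κu)) := by
  rw [S.inputOutputLaw_eq_awgnLaw]
  refine (mutualInfo_awgnLaw_le (measurable_dotProduct _) (memLp_dotProduct hP _)
    (S.noiseVar_ne_zero P h)).trans (ENNReal.ofReal_le_ofReal ?_)
  have hE : 0 ≤ ∫ x, ‖dotProduct (star h) x‖ ^ 2 ∂P := integral_nonneg fun _ => by positivity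
  have hD : 0 ≤ ∑ i, ‖h i‖ ^ 2 * ∫ x, ‖x i‖ ^ 2 ∂P :=
    Finset.sum_nonneg fun i _ => mul_nonneg (by positivity) (integral_nonneg fun _ => by positivity)
  have hκ : (0 : ℝ) < S.κu := S.κu_pos
  have hσ : (0 : ℝ) < S.σ2 := S.σ2_pos
  have hb : (0 : ℝ) ≤ S.κb := S.κb.2
  have hv := S.coe_noiseVar hP h
  set E := ∫ x, ‖dotProduct (star h) x‖ ^ 2 ∂P
  set D := ∑ i, ‖h i‖ ^ 2 * ∫ x, ‖x i‖ ^ 2 ∂P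
  have hle : S.κu * E ≤ S.noiseVar P h := by
    rw [hv, mul_add]
    have : 0 ≤ S.κb * D := by positivity
    have : 0 ≤ S.κu * (S.κb * D) := by positivity
    linarith
  have hv0 : (0 : ℝ) < S.noiseVar P h := by
    rw [hv]; positivity
  refine Real.logb_le_logb_of_le one_lt_two (by positivity) ?_
  gcongr 1 + ?_
  rw [div_le_div_iff₀ hv0 hκ]
  linarith

lemma integral_normSq_apply_pi_cscg (e : ℝ≥0) (i : Fin M) :
    ∫ x, ‖x i‖ ^ 2 ∂(Measure.pi fun _ : Fin M => cscg e) = e := by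
  have h := integral_map (μ := Measure.pi fun _ : Fin M => cscg e)
    (measurable_pi_apply i).aemeasurable (f := fun z : ℂ => ‖z‖ ^ 2) (by fun_prop)
  rw [← h, ← integral_normSq_cscg e]
  congr 1
  exact (measurePreserving_eval (fun _ : Fin M => cscg e) i).map_eq

lemma lintegral_power_pi_cscg (e : ℝ≥0) :
    ∫⁻ x, ∑ i, ‖x i‖ₑ ^ 2 ∂(Measure.pi fun _ : Fin M => cscg e) = (M * e : ℝ≥0) := by
  rw [lintegral_finsetSum _ fun i _ => by fun_prop]
  have h : ∀ i : Fin M, ∫⁻ x, ‖x i‖ₑ ^ 2 ∂(Measure.pi fun _ : Fin M => cscg e) = e := fun i => by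
    have h := (measurePreserving_eval (fun _ : Fin M => cscg e) i).lintegral_comp
      (f := fun z : ℂ => ‖z‖ₑ ^ 2) (by fun_prop)
    rw [h]
    have h2 := ofReal_integral_eq_lintegral_ofReal (integrable_normSq_cscg e)
      (ae_of_all _ fun _ => by positivity)
    rw [integral_normSq_cscg, ENNReal.ofReal_coe_nnreal] at h2
    rw [h2]
    refine lintegral_congr fun z => ?_
    rw [← ofReal_norm, ENNReal.ofReal_pow (norm_nonneg _)]
  simp_rw [h]
  simp

/-- Mutual information achieved by an isotropic Gaussian input of power `e` per antenna. -/
lemma System.mutualInfo_inputOutputLaw_pi_cscg (S : System) (e : ℝ≥0) (h : Fin M → ℂ) :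
    mutualInfo (S.inputOutputLaw (Measure.pi fun _ => cscg e) h) =
      ENNReal.ofReal (Real.logb 2 (1 + (e * ∑ i, ‖h i‖ ^ 2) /
        ((e * ∑ i, ‖h i‖ ^ 2) * (S.κb + S.κu * (1 + S.κb)) + S.σ2))) := by
  have hP : ∀ i, MemLp (fun x : Fin M → ℂ => x i) 2 (Measure.pi fun _ => cscg e) :=
    memLp_apply_of_power (lintegral_power_pi_cscg e)
  have hmap := map_dotProduct_pi_cscg (star h) fun _ => e
  rw [S.inputOutputLaw_eq_awgnLaw, mutualInfo_awgnLaw_of_gaussian (measurable_dotProduct _)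
    (S.noiseVar_ne_zero _ h) hmap, S.coe_noiseVar hP]
  -- Without correlation between antennas, the received signal power equals the sum of the
  -- per-antenna powers weighted by the gains, which also governs the distortion.
  have hE : ∫ x, ‖dotProduct (star h) x‖ ^ 2 ∂(Measure.pi fun _ : Fin M => cscg e) =
      e * ∑ i, ‖h i‖ ^ 2 := by
    have h3 := integral_map (μ := Measure.pi fun _ : Fin M => cscg e)
      (measurable_dotProduct (star h)).aemeasurable (f := fun z : ℂ => ‖z‖ ^ 2) (by fun_prop)
    rw [← h3, hmap, integral_normSq_cscg]
    push_cast
    rw [← Finset.sum_mul, mul_comm]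
    simp
  rw [hE]
  simp_rw [integral_normSq_apply_pi_cscg]
  rw [← Finset.sum_mul]
  push_cast
  rw [← Finset.sum_mul]
  simp only [Pi.star_apply, norm_star]
  congr 4 <;> ring

end Link

/-! ### Bounds on the energy efficiency -/

lemma System.capacity_le (S : System) {M N : ℕ} {B U : Type*} [MeasurableSpace B]
    [MeasurableSpace U] (csi : Measure (State M N × B × U)) [IsProbabilityMeasure csi]
    (pb : ℝ≥0) :
    S.capacity csi pb ≤
      ((S.τd / S.τ : ℝ≥0) : ℝ≥0∞) * ENNReal.ofReal (Real.logb 2 (1 + 1 / S.κu)) := by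
  refine mul_le_mul_right (iSup_le fun f => ?_) _
  have := f.markov
  calc ∫⁻ ω, mutualInfo (S.inputOutputLaw (f.law ω.2.1) (overallChannel ω.1 (f.phase ω.2.1))) ∂csi
      ≤ ∫⁻ _, ENNReal.ofReal (Real.logb 2 (1 + 1 / S.κu)) ∂csi :=
        lintegral_mono fun ω => S.mutualInfo_inputOutputLaw_le
          (memLp_apply_of_power (f.power ω.2.1)) _
    _ = ENNReal.ofReal (Real.logb 2 (1 + 1 / S.κu)) := by simp

/-- The strategy that sends an isotropic Gaussian signal, whatever the channel information. -/
noncomputable def isotropicStrategy (M N : ℕ) (B : Type*) [MeasurableSpace B] (e : ℝ≥0) :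
    Strategy M N B (M * e) where
  law := Kernel.const B (Measure.pi fun _ => cscg e)
  markov := inferInstance
  power _ := lintegral_power_pi_cscg e
  phase _ := 0
  phase_measurable := measurable_const
  phase_mem _ _ := ⟨le_rfl, by simpa using Real.pi_pos.le⟩

/-- The isotropic strategy ignores the channel information, so only the law of the state matters.
Its rate increases with the gain, and low-gain states are counted as rate zero. -/
lemma System.le_capacity (S : System) {M N : ℕ} {B U : Type*} [MeasurableSpace B]
    [MeasurableSpace U] (csi : Measure (State M N × B × U)) (hcsi : csi.fst = S.stateLaw M N)
    (e : ℝ≥0) {K ε : ℝ} (hK : 0 ≤ K) (hε : 0 ≤ ε)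
    (hst : S.stateLaw M N {s | ∑ m, ‖overallChannel s 0 m‖ ^ 2 ≤ M * K} ≤ ENNReal.ofReal ε) :
    ENNReal.ofReal (S.τd / S.τ * (Real.logb 2 (1 + M * e * K /
      (M * e * K * (S.κb + S.κu * (1 + S.κb)) + S.σ2)) * (1 - ε))) ≤
      S.capacity csi (M * e) := by
  set L := Real.logb 2 (1 + M * e * K / (M * e * K * (S.κb + S.κu * (1 + S.κb)) + S.σ2)) with hL
  have hσ : (0 : ℝ) < S.σ2 := S.σ2_pos
  have hL0 : 0 ≤ L := Real.logb_nonneg one_lt_two (le_add_of_nonneg_right (by positivity))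
  set T := {s : State M N | ∑ m, ‖overallChannel s 0 m‖ ^ 2 ≤ M * K} with hT
  have hTm : MeasurableSet T := by
    have := fun m => measurable_overallChannel (M := M) (N := N) 0 m
    exact measurableSet_le (by fun_prop) (by fun_prop)
  rw [ENNReal.ofReal_mul (by positivity), System.capacity]
  have hτ : ENNReal.ofReal (S.τd / S.τ) = ((S.τd / S.τ : ℝ≥0) : ℝ≥0∞) := by
    rw [← NNReal.coe_div, ENNReal.ofReal_coe_nnreal]
  rw [hτ]
  refine mul_le_mul_right (le_trans ?_ (le_iSup _ (isotropicStrategy M N B e))) _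
  have hlow : ∀ ω : State M N × B × U,
      (Prod.fst ⁻¹' Tᶜ).indicator (fun _ => ENNReal.ofReal L) ω ≤
      mutualInfo (S.inputOutputLaw ((isotropicStrategy M N B e).law ω.2.1)
        (overallChannel ω.1 ((isotropicStrategy M N B e).phase ω.2.1))) := by
    intro ω
    by_cases hω : ω ∈ Prod.fst ⁻¹' Tᶜ
    swap
    · rw [Set.indicator_of_notMem hω]
      exact zero_le
    rw [Set.indicator_of_mem hω]
    have hgain : M * K < ∑ m, ‖overallChannel ω.1 0 m‖ ^ 2 := by
      simpa [hT] using hω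
    refine le_of_le_of_eq (ENNReal.ofReal_le_ofReal ?_)
      (S.mutualInfo_inputOutputLaw_pi_cscg e (overallChannel ω.1 0)).symm
    have hle : M * e * K ≤ e * ∑ m, ‖overallChannel ω.1 0 m‖ ^ 2 := by
      have := mul_le_mul_of_nonneg_left hgain.le e.coe_nonneg
      calc M * e * K = e * (M * K) := by ring
        _ ≤ _ := this
    set t := M * e * K with ht
    set a := e * ∑ m, ‖overallChannel ω.1 0 m‖ ^ 2
    have ht0 : 0 ≤ t := by positivity
    have ha0 : 0 ≤ a := ht0.trans hle
    refine Real.logb_le_logb_of_le one_lt_two (by positivity) ?_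
    gcongr 1 + ?_
    rw [div_le_div_iff₀ (by positivity) (by positivity)]
    -- After cross-multiplication the κ terms cancel and t σ² ≤ a σ² remains.
    have := mul_le_mul_of_nonneg_right hle hσ.le
    nlinarith
  refine le_trans ?_ (lintegral_mono hlow)
  rw [lintegral_indicator_const (measurable_fst hTm.compl), ← Measure.fst_apply hTm.compl, hcsi,
    ENNReal.ofReal_mul hL0, prob_compl_eq_one_sub hTm]
  gcongr
  rw [ENNReal.ofReal_sub _ hε, ENNReal.ofReal_one]
  exact tsub_le_tsub_left hst 1

section Efficiency

variable {B U : ℕ → ℕ → Type*} [∀ M N, MeasurableSpace (B M N)] [∀ M N, MeasurableSpace (U M N)]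

lemma System.ChannelInfo.isProbabilityMeasure_joint {S : System} (C : S.ChannelInfo B U)
    (M N : ℕ) (pb pu : ℝ≥0) : IsProbabilityMeasure (C.joint M N pb pu) :=
  ⟨by rw [← Measure.fst_univ, C.fst_joint, measure_univ]⟩

lemma System.logb_one_add_inv_nonneg (S : System) : 0 ≤ Real.logb 2 (1 + 1 / S.κu) :=
  Real.logb_nonneg one_lt_two (le_add_of_nonneg_right (by positivity))

lemma System.maxEfficiencyAt_le (S : System) (C : S.ChannelInfo B U) (M : ℕ) :
    S.maxEfficiencyAt C M ≤ ENNReal.ofReal (S.τd / S.τ * Real.logb 2 (1 + 1 / S.κu) /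
      (S.τd / (S.τu + S.τd) * (M * S.ρ + S.ζ))) := by
  refine iSup_le fun N => iSup_le fun pb => iSup_le fun pu => ?_
  have := C.isProbabilityMeasure_joint M N pb pu
  have hτ := S.τ_pos
  have hτd := S.τd_pos
  have hζ := S.ζ_pos
  have hL := S.logb_one_add_inv_nonneg
  have hpos : (0 : ℝ) < S.τd / (S.τu + S.τd) * (M * S.ρ + S.ζ) := by positivity
  rw [ENNReal.ofReal_div_of_pos hpos, ENNReal.ofReal_mul (by positivity), System.energyEfficiency]
  have h1 : ENNReal.ofReal (S.τd / S.τ) = ((S.τd / S.τ : ℝ≥0) : ℝ≥0∞) := by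
    rw [← NNReal.coe_div, ENNReal.ofReal_coe_nnreal]
  have h2 : ENNReal.ofReal (S.τd / (S.τu + S.τd) * (M * S.ρ + S.ζ)) =
      ((S.τd / (S.τu + S.τd) * (M * S.ρ + S.ζ) : ℝ≥0) : ℝ≥0∞) := by
    rw [← ENNReal.ofReal_coe_nnreal]; push_cast; rfl
  rw [h1, h2]
  refine ENNReal.div_le_div (S.capacity_le _ pb) (ENNReal.coe_le_coe.2 ?_)
  rw [System.downlinkPower, add_assoc (S.τpilot * pu / S.τ)]
  exact (mul_le_mul_right le_add_self _).trans le_self_add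

lemma System.maxEfficiency_le (S : System) (C : S.ChannelInfo B U) :
    S.maxEfficiency C ≤ ENNReal.ofReal S.upperBound := by
  refine iSup_le fun M => (S.maxEfficiencyAt_le C M).trans (ENNReal.ofReal_le_ofReal ?_)
  have hτ : (0 : ℝ) < S.τ := S.τ_pos
  have hτd : (0 : ℝ) < S.τd := S.τd_pos
  have hζ : (0 : ℝ) < S.ζ := S.ζ_pos
  have hL := S.logb_one_add_inv_nonneg
  calc S.τd / S.τ * Real.logb 2 (1 + 1 / S.κu) / (S.τd / (S.τu + S.τd) * (M * S.ρ + S.ζ))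
      ≤ S.τd / S.τ * Real.logb 2 (1 + 1 / S.κu) / (S.τd / (S.τu + S.τd) * S.ζ) := by
        gcongr
        exact le_add_of_nonneg_left (by positivity)
    _ = S.upperBound := by
        rw [System.upperBound]
        field_simp

lemma System.tendsto_maxEfficiencyAt (S : System) (C : S.ChannelInfo B U) (hρ : 0 < S.ρ) :
    Tendsto (fun M : ℕ => S.maxEfficiencyAt C M) atTop (𝓝 0) := by
  have hτd : (0 : ℝ) < S.τd := S.τd_pos
  have hρ' : (0 : ℝ) < S.ρ := hρ
  have h : Tendsto (fun M : ℕ => S.τd / S.τ * Real.logb 2 (1 + 1 / S.κu) /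
      (S.τd / (S.τu + S.τd) * (M * S.ρ + S.ζ))) atTop (𝓝 0) := by
    refine Tendsto.div_atTop tendsto_const_nhds (Tendsto.const_mul_atTop (by positivity) ?_)
    exact tendsto_atTop_add_const_right _ _
      (tendsto_natCast_atTop_atTop.atTop_mul_const hρ')
  have h2 := ENNReal.tendsto_ofReal h
  rw [ENNReal.ofReal_zero] at h2
  exact tendsto_of_tendsto_of_tendsto_of_le_of_le tendsto_const_nhds h2 (fun _ => zero_le)
    (S.maxEfficiencyAt_le C)

/-- A sequence that tends to its least possible value attains its supremum. -/
lemma exists_eq_iSup_of_tendsto_bot {α : Type*} [CompleteLinearOrder α] [TopologicalSpace α]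
    [OrderTopology α] {u : ℕ → α} (hu : Tendsto u atTop (𝓝 ⊥)) : ∃ n, u n = ⨆ k, u k := by
  by_cases h : ∀ n, u n = ⊥
  · exact ⟨0, by simp [h]⟩
  push Not at h
  obtain ⟨m, hm⟩ := h
  obtain ⟨n₀, hn₀⟩ := eventually_atTop.1 (hu.eventually_lt_const (bot_lt_iff_ne_bot.2 hm))
  -- The range contains m and every index below n₀; all later terms lie below u m.
  obtain ⟨n, -, hn⟩ := Finset.exists_max_image (Finset.range (max n₀ m + 1)) u ⟨0, by simp⟩
  refine ⟨n, le_antisymm (le_iSup u n) (iSup_le fun k => ?_)⟩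
  by_cases hk : k < n₀
  · exact hn k (Finset.mem_range.2 (by omega))
  · exact (hn₀ k (not_lt.1 hk)).le.trans (hn m (Finset.mem_range.2 (by omega)))

/-- One parameter serves as transmit power x, outage probability x and gain level 1/x². The received
power is then at least 1/x outside the outage, and relative to 1/x the thermal noise is σ² x. -/
lemma System.le_maxEfficiency_of_power (S : System) (C : S.ChannelInfo B U) (hρ : S.ρ = 0)
    {x : ℝ} (hx : 0 < x) :
    ENNReal.ofReal (S.τd / S.τ * (Real.logb 2 (1 + 1 /
      ((S.κb + S.κu * (1 + S.κb)) + S.σ2 * x)) * (1 - x)) /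
      (S.τd / (S.τu + S.τd) * S.ζ + S.τd * x / S.τ)) ≤ S.maxEfficiency C := by
  obtain ⟨M, N, hM, hst⟩ := S.exists_stateLaw_gain_le (1 / x ^ 2) (ENNReal.ofReal_pos.2 hx)
  have hM0 : (M : ℝ) ≠ 0 := by exact_mod_cast hM.ne'
  -- Power per antenna, so that the total stays x however large M is.
  set e : ℝ≥0 := Real.toNNReal x / M with he
  have hτ := S.τ_pos
  have hτd := S.τd_pos
  have hζ := S.ζ_pos
  have heR : (M : ℝ) * e = x := by
    rw [he]; push_cast; rw [Real.coe_toNNReal _ hx.le]; field_simp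
  have hcap := S.le_capacity (C.joint M N (M * e) 0) (C.fst_joint _ _ _ _) e
    (by positivity) hx.le hst
  have hpow : (S.downlinkPower M (M * e) 0 : ℝ) =
      S.τd / (S.τu + S.τd) * S.ζ + S.τd * x / S.τ := by
    rw [System.downlinkPower, hρ]; push_cast; rw [heR]; ring
  have hpos : (0 : ℝ) < S.τd / (S.τu + S.τd) * S.ζ + S.τd * x / S.τ := by positivity
  refine le_trans ?_ (le_iSup_of_le M (le_iSup_of_le N (le_iSup_of_le (M * e)
    (le_iSup_of_le 0 le_rfl))))
  rw [System.energyEfficiency, ENNReal.ofReal_div_of_pos hpos, ← hpow, ENNReal.ofReal_coe_nnreal]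
  refine ENNReal.div_le_div_right (le_of_eq_of_le ?_ hcap) _
  rw [heR]
  have hσ : (0 : ℝ) < S.σ2 := S.σ2_pos
  have hκ : (0 : ℝ) < S.κb + S.κu * (1 + S.κb) := by
    have : (0 : ℝ) < S.κu := S.κu_pos
    positivity
  congr 5
  field_simp

/-- The bound for transmit power x is continuous at x = 0, where it equals the claimed value,
although x = 0 itself is not admissible. -/
lemma System.le_maxEfficiency (S : System) (C : S.ChannelInfo B U) (hρ : S.ρ = 0) :
    ENNReal.ofReal S.lowerBound ≤ S.maxEfficiency C := by
  have hτ : (0 : ℝ) < S.τ := S.τ_pos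
  have hτd : (0 : ℝ) < S.τd := S.τd_pos
  have hζ : (0 : ℝ) < S.ζ := S.ζ_pos
  have hκ : (0 : ℝ) < S.κb + S.κu * (1 + S.κb) := by
    have : (0 : ℝ) < S.κu := S.κu_pos
    positivity
  set κ : ℝ := S.κb + S.κu * (1 + S.κb) with hκ_def
  let F : ℝ → ℝ := fun x => S.τd / S.τ * (Real.logb 2 (1 + 1 / (κ + S.σ2 * x)) * (1 - x)) /
      (S.τd / (S.τu + S.τd) * S.ζ + S.τd * x / S.τ)
  have hF0 : F 0 = S.lowerBound := by
    simp only [F, System.lowerBound, ← hκ_def]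
    field_simp
    simp
    ring
  have hF : ContinuousAt F 0 := by
    have h1 : κ + S.σ2 * (0 : ℝ) ≠ 0 := by simpa using hκ.ne'
    have h2 : (1 : ℝ) + 1 / (κ + S.σ2 * 0) ≠ 0 := by
      rw [mul_zero, add_zero]; positivity
    have h3 : S.τd / (S.τu + S.τd) * S.ζ + S.τd * (0 : ℝ) / S.τ ≠ 0 := by
      rw [mul_zero, zero_div, add_zero]; positivity
    simp only [F, Real.logb]
    fun_prop (disch := assumption)
  have hlim := ENNReal.tendsto_ofReal
    (hF.tendsto.comp (tendsto_one_div_add_atTop_nhds_zero_nat (𝕜 := ℝ)))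
  rw [hF0] at hlim
  exact le_of_tendsto' hlim fun n => S.le_maxEfficiency_of_power C hρ (by positivity)

end Efficiency

end IRS

theorem theorem7 (S : IRS.System) {B U : ℕ → ℕ → Type*}
    [∀ M N, MeasurableSpace (B M N)] [∀ M N, MeasurableSpace (U M N)]
    (C : S.ChannelInfo B U) :
    (S.ρ = 0 →
      ENNReal.ofReal S.lowerBound ≤ S.maxEfficiency C ∧
      S.maxEfficiency C ≤ ENNReal.ofReal S.upperBound) ∧
    (0 < S.ρ →
      S.maxEfficiency C ≤ ENNReal.ofReal S.upperBound ∧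
      Tendsto (fun M : ℕ => S.maxEfficiencyAt C M) atTop (𝓝 0) ∧
      ∃ M : ℕ, S.maxEfficiencyAt C M = S.maxEfficiency C) :=
  ⟨fun hρ => ⟨S.le_maxEfficiency C hρ, S.maxEfficiency_le C⟩,
    fun hρ => ⟨S.maxEfficiency_le C, S.tendsto_maxEfficiencyAt C hρ,
      IRS.exists_eq_iSup_of_tendsto_bot (S.tendsto_maxEfficiencyAt C hρ)⟩⟩
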